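/- For a vector $c=(x_1,\dots,x_{10},y_1,y_2)\in\mathbb F_3^{12}$ write $x=(x_1,\dots,x_{10})$, and let $\mathrm{wt}$ denote the Hamming weight. A ternary $[n,k,d]$ code is a $k$-dimensional subspace of $\mathbb F_3^n$ whose minimum non-zero weight is $d$. Consider the following conditions on a ternary $[12,5]$ code $C$, required for every codeword $c=(x_1,\dots,x_{10},y_1,y_2)\in C$: (C1) $\mathrm{wt}(x)\equiv y_1y_2 \pmod 3$; (C2) if $c\neq 0$, then $\mathrm{wt}(x)\ge 3$; (C3) if $\mathrm{wt}(x)=3$, then $(y_1,y_2)\ne(0,0)$. Two ternary codes of length $12$ are SZ-equivalent if one is the image of the other under a map $$(x_1,\dots,x_{10},y_1,y_2)\mapsto((-1)^{\alpha_1}x_{\sigma(1)},\dots,(-1)^{\alpha_{10}}x_{\sigma(10)},(-1)^{\beta}y_{\tau(1)},(-1)^{\beta}y_{\tau(2)})$$ with $\alpha_1,\dots,\alpha_{10},\beta\in\{0,1\}$, $\sigma\in S_{10}$, $\tau\in S_2$. Two ternary codes of length $10$ are equivalent if one is obtained from the other by permuting the coordinates and changing the signs of certain coordinates. The punctured code $\mathrm{Pun}(C)\subseteq\mathbb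 F_3^{10}$ is obtained by deleting the last two coordinates of every codeword. For $i\in\{302,666,987,1245\}$ let $C_{10,3,i}$ be the ternary code of length $10$ with generator matrix $(I_5\mid A_i)$, and let $D_i$ be the ternary code of length $12$ with generator matrix $(I_5\mid A_i\mid B_i)$, where $$A_{302}=\begin{pmatrix}0&0&0&1&1\\0&1&1&0&0\\1&0&1&0&1\\1&1&0&1&0\\1&1&2&2&1\end{pmatrix},\ B_{302}=\begin{pmatrix}0&1\\0&1\\2&2\\2&2\\0&1\end{pmatrix},\quad A_{666}=\begin{pmatrix}0&0&0&1&1\\0&1&1&0&0\\1&0&1&0&1\\1&1&0&1&0\\1&2&2&2&2\end{pmatrix},\ B_{666}=\begin{pmatrix}0&1\\0&1\\2&2\\2&2\\2&0\end{pmatrix},$$ $$A_{987}=\begin{pmatrix}0&0&0&1&1\\0&0&1&0&1\\0&1&0&1&0\\0&1&1&0&0\\1&1&2&2&1\end{pmatrix},\ B_{987}=\begin{pmatrix}0&1\\2&0\\2&0\\0&1\\0&0\end{pmatrix},\quad A_{1245}=\begin{pmatrix}0&0&0&1&1\\0&0&1&0&1\\0&1&0&1&0\\0&1&1&0&0\\0&1&1&1&1\end{pmatrix},\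 B_{1245}=\begin{pmatrix}0&1\\2&0\\2&0\\0&1\\1&2\end{pmatrix}.$$ Lemma. Up to SZ-equivalence, there are exactly four ternary $[12,5,4]$ codes satisfying (C1)–(C3). More precisely, $D_{302},D_{666},D_{987},D_{1245}$ are ternary $[12,5,4]$ codes satisfying (C1)–(C3), and every ternary $[12,5,4]$ code satisfying (C1)–(C3) is SZ-equivalent to exactly one of them. Moreover $\mathrm{Pun}(D_i)=C_{10,3,i}$, the codes $C_{10,3,i}$ are pairwise inequivalent ternary $[10,5,3]$ codes, and for every ternary $[12,5,4]$ code $C$ satisfying (C1)–(C3), $\mathrm{Pun}(C)$ is a ternary $[10,5,3]$ code equivalent to exactly one of the four codes $C_{10,3,i}$. -/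

import Mathlib

/-- `C` is a ternary `[n, k, d]` code: a `k`-dimensional subspace of `𝔽₃ⁿ` whose minimum weight,
i.e. the least Hamming weight of a non-zero codeword, is `d`. -/
def IsTernaryCode {n : ℕ} (C : Submodule (ZMod 3) (Fin n → ZMod 3)) (k d : ℕ) : Prop :=
  Module.finrank (ZMod 3) C = k ∧ IsLeast {w : ℕ | ∃ c ∈ C, c ≠ 0 ∧ hammingNorm c = w} d

/-- `(x₁,…,x₁₀)` for a vector `(x₁,…,x₁₀,y₁,y₂)`, i.e. deletion of the coordinates 11 and 12. -/
def xPart : (Fin 12 → ZMod 3) →ₗ[ZMod 3] (Fin 10 → ZMod 3) where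
  toFun c := fun i => c (Fin.castAdd 2 i)
  map_add' _ _ := rfl
  map_smul' _ _ := rfl

/-- `(y₁,y₂)` for a vector `(x₁,…,x₁₀,y₁,y₂)`. -/
def yPart : (Fin 12 → ZMod 3) →ₗ[ZMod 3] (Fin 2 → ZMod 3) where
  toFun c := fun j => c (Fin.natAdd 10 j)
  map_add' _ _ := rfl
  map_smul' _ _ := rfl

/-- The punctured code of `C` on the coordinates `{11, 12}`. -/
def Pun (C : Submodule (ZMod 3) (Fin 12 → ZMod 3)) : Submodule (ZMod 3) (Fin 10 → ZMod 3) :=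
  C.map xPart

/-- The three conditions on a ternary code of length 12. -/
structure SZConditions (C : Submodule (ZMod 3) (Fin 12 → ZMod 3)) : Prop where
  c1 : ∀ c ∈ C, (hammingNorm (xPart c) : ZMod 3) = yPart c 0 * yPart c 1
  c2 : ∀ c ∈ C, c ≠ 0 → 3 ≤ hammingNorm (xPart c)
  c3 : ∀ c ∈ C, hammingNorm (xPart c) = 3 → (yPart c 0, yPart c 1) ≠ (0, 0)

/-- The map `(x₁,…,xₙ) ↦ ((-1)^α₁ x_{σ(1)},…,(-1)^αₙ x_{σ(n)})`. -/
def signedPerm {n : ℕ} (α : Fin n → Fin 2) (σ : Equiv.Perm (Fin n)) :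
    (Fin n → ZMod 3) →ₗ[ZMod 3] (Fin n → ZMod 3) where
  toFun x := fun i => (-1) ^ (α i : ℕ) * x (σ i)
  map_add' x y := by ext i; simp [mul_add]
  map_smul' r x := by ext i; simp [mul_left_comm]

/-- Usual equivalence of ternary codes: permuting coordinates and changing signs of some. -/
def CodeEquiv {n : ℕ} (C C' : Submodule (ZMod 3) (Fin n → ZMod 3)) : Prop :=
  ∃ (α : Fin n → Fin 2) (σ : Equiv.Perm (Fin n)), C' = C.map (signedPerm α σ)

/-- The map `(x₁,…,x₁₀,y₁,y₂) ↦
((-1)^α₁ x_{σ(1)},…,(-1)^α₁₀ x_{σ(10)}, (-1)^β y_{τ(1)}, (-1)^β y_{τ(2)})`. -/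
def szMap (α : Fin 10 → Fin 2) (β : Fin 2) (σ : Equiv.Perm (Fin 10)) (τ : Equiv.Perm (Fin 2)) :
    (Fin 12 → ZMod 3) →ₗ[ZMod 3] (Fin 12 → ZMod 3) where
  toFun c := Fin.append (m := 10) (n := 2)
    (fun i => (-1) ^ (α i : ℕ) * xPart c (σ i)) (fun j => (-1) ^ (β : ℕ) * yPart c (τ j))
  map_add' c d := by
    ext i
    refine Fin.addCases (m := 10) (n := 2) (fun i => ?_) (fun i => ?_) i
    · simp only [Pi.add_apply, Fin.append_left, map_add, mul_add]
    · simp only [Pi.add_apply, Fin.append_right, map_add, mul_add]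
  map_smul' r c := by
    ext i
    refine Fin.addCases (m := 10) (n := 2) (fun i => ?_) (fun i => ?_) i
    · simp only [Pi.smul_apply, Fin.append_left, map_smul, smul_eq_mul, RingHom.id_apply,
        mul_left_comm]
    · simp only [Pi.smul_apply, Fin.append_right, map_smul, smul_eq_mul, RingHom.id_apply,
        mul_left_comm]

/-- SZ-equivalence of ternary codes of length 12. -/
def SZEquiv (C C' : Submodule (ZMod 3) (Fin 12 → ZMod 3)) : Prop :=
  ∃ (α : Fin 10 → Fin 2) (β : Fin 2) (σ : Equiv.Perm (Fin 10)) (τ : Equiv.Perm (Fin 2)),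
    C' = C.map (szMap α β σ τ)

lemma neg_one_pow_fin_two_add (a b : Fin 2) :
    ((-1) ^ ((a + b : Fin 2) : ℕ) : ZMod 3) = (-1) ^ (a : ℕ) * (-1) ^ (b : ℕ) := by
  revert a b; decide

lemma szMap_id : szMap 0 0 1 1 = LinearMap.id := by
  refine LinearMap.ext fun c => funext fun i => ?_
  refine Fin.addCases (m := 10) (n := 2) (fun i => ?_) (fun i => ?_) i <;>
    simp [szMap, xPart, yPart]

lemma szMap_comp (α α' : Fin 10 → Fin 2) (β β' : Fin 2) (σ σ' : Equiv.Perm (Fin 10))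
    (τ τ' : Equiv.Perm (Fin 2)) :
    (szMap α' β' σ' τ').comp (szMap α β σ τ) =
      szMap (fun i => α' i + α (σ' i)) (β' + β) (σ * σ') (τ * τ') := by
  refine LinearMap.ext fun c => funext fun i => ?_
  refine Fin.addCases (m := 10) (n := 2) (fun i => ?_) (fun i => ?_) i <;>
    simp [szMap, xPart, yPart, neg_one_pow_fin_two_add, mul_assoc]

lemma szEquiv_equivalence : Equivalence SZEquiv where
  refl C := ⟨0, 0, 1, 1, by rw [szMap_id, Submodule.map_id]⟩
  symm := by
    rintro C C' ⟨α, β, σ, τ, rfl⟩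
    have h2 : ∀ a : Fin 2, a + a = 0 := by decide
    refine ⟨fun i => α (σ⁻¹ i), β, σ⁻¹, τ⁻¹, ?_⟩
    rw [← Submodule.map_comp, szMap_comp]
    simp only [h2, mul_inv_cancel]
    exact (congrArg (fun f => C.map f) szMap_id |>.trans (Submodule.map_id C)).symm
  trans := by
    rintro C C' C'' ⟨α, β, σ, τ, rfl⟩ ⟨α', β', σ', τ', rfl⟩
    exact ⟨_, _, _, _, by rw [← Submodule.map_comp, szMap_comp]⟩

/-- The ternary `[12, 5, 4]` codes satisfying the three conditions. -/
def SZCode : Type :=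
  {C : Submodule (ZMod 3) (Fin 12 → ZMod 3) // IsTernaryCode C 5 4 ∧ SZConditions C}

/-- SZ-equivalence of ternary `[12, 5, 4]` codes satisfying the three conditions. -/
def szSetoid : Setoid SZCode where
  r C C' := SZEquiv C.1 C'.1
  iseqv := ⟨fun C => szEquiv_equivalence.refl C.1, fun h => szEquiv_equivalence.symm h,
    fun h h' => szEquiv_equivalence.trans h h'⟩

/-- The code with generator matrix `G`. -/
def codeOf {k n : ℕ} (G : Matrix (Fin k) (Fin n) (ZMod 3)) :
    Submodule (ZMod 3) (Fin n → ZMod 3) :=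
  Submodule.span (ZMod 3) (Set.range G.row)

/-- Generator matrices `(I₅ | A)` of the codes `C_{10,3,302}`, `C_{10,3,666}`, `C_{10,3,987}`,
`C_{10,3,1245}`, in this order. -/
def G10 : Fin 4 → Matrix (Fin 5) (Fin 10) (ZMod 3) := ![
  !![1, 0, 0, 0, 0, 0, 0, 0, 1, 1;
     0, 1, 0, 0, 0, 0, 1, 1, 0, 0;
     0, 0, 1, 0, 0, 1, 0, 1, 0, 1;
     0, 0, 0, 1, 0, 1, 1, 0, 1, 0;
     0, 0, 0, 0, 1, 1, 1, 2, 2, 1],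
  !![1, 0, 0, 0, 0, 0, 0, 0, 1, 1;
     0, 1, 0, 0, 0, 0, 1, 1, 0, 0;
     0, 0, 1, 0, 0, 1, 0, 1, 0, 1;
     0, 0, 0, 1, 0, 1, 1, 0, 1, 0;
     0, 0, 0, 0, 1, 1, 2, 2, 2, 2],
  !![1, 0, 0, 0, 0, 0, 0, 0, 1, 1;
     0, 1, 0, 0, 0, 0, 0, 1, 0, 1;
     0, 0, 1, 0, 0, 0, 1, 0, 1, 0;
     0, 0, 0, 1, 0, 0, 1, 1, 0, 0;
     0, 0, 0, 0, 1, 1, 1, 2, 2, 1],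
  !![1, 0, 0, 0, 0, 0, 0, 0, 1, 1;
     0, 1, 0, 0, 0, 0, 0, 1, 0, 1;
     0, 0, 1, 0, 0, 0, 1, 0, 1, 0;
     0, 0, 0, 1, 0, 0, 1, 1, 0, 0;
     0, 0, 0, 0, 1, 0, 1, 1, 1, 1]]

/-- The columns `(aᵀ, bᵀ)` by which the four matrices of `G10` are extended. -/
def ab : Fin 4 → Matrix (Fin 5) (Fin 2) (ZMod 3) := ![
  !![0, 1; 0, 1; 2, 2; 2, 2; 0, 1],
  !![0, 1; 0, 1; 2, 2; 2, 2; 2, 0],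
  !![0, 1; 2, 0; 2, 0; 0, 1; 0, 0],
  !![0, 1; 2, 0; 2, 0; 0, 1; 1, 2]]

/-- The codes `C_{10,3,302}`, `C_{10,3,666}`, `C_{10,3,987}`, `C_{10,3,1245}`. -/
def C10 (i : Fin 4) : Submodule (ZMod 3) (Fin 10 → ZMod 3) := codeOf (G10 i)

/-- The codes of length 12 with generator matrices `(I₅ | A | aᵀ bᵀ)`. -/
def C12 (i : Fin 4) : Submodule (ZMod 3) (Fin 12 → ZMod 3) :=
  codeOf (Matrix.of fun r => Fin.append (m := 10) (n := 2) (G10 i r) (ab i r))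

/-!
By (C1) the codewords of such a code are pairwise orthogonal for the form
`x ⬝ x' + y₁ y₂' + y₂ y₁'`, and, the dimension being 5, any four coordinates vanish at some nonzero
codeword. A codeword of weight 4 has `wt x = 3`. Starting from it, one finds further codewords by
prescribing four zeros; orthogonality to the words already normalised leaves a few parameters, which
(C1)–(C3) and signed permutations reduce to finitely many normal forms. After the second step there
are either three words with `wt x = 3` and disjoint `x`-supports, which leads to `D₆₆₆` and `D₁₂₄₅`,
or not, which leads to `D₃₀₂` and `D₉₈₇`. The four punctured codes have 4, 6, 8 and 12 words of
weight 3, hence are inequivalent, and so are the four codes of length 12.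
-/

open Function

lemma natCard_quotient_eq {α ι : Type*} (s : Setoid α) (f : ι → α) (h : ∀ a, ∃! i, s a (f i)) :
    Nat.card (Quotient s) = Nat.card ι := by
  refine (Nat.card_congr <| Equiv.ofBijective (fun i => (⟦f i⟧ : Quotient s)) ⟨?_, ?_⟩).symm
  · exact fun i j hij => (h (f i)).unique (s.refl _) (Quotient.exact hij)
  · exact Quotient.ind fun a => (h a).exists.imp fun i hi => Quotient.sound (s.symm hi)

lemma exists_perm_of_map_univ_val_eq {ι α : Type*} [Fintype ι] {f g : ι → α}
    (h : Finset.univ.val.map f = Finset.univ.val.map g) :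
    ∃ σ : Equiv.Perm ι, ∀ i, f (σ i) = g i := by
  classical
  have hcard (a : α) : Fintype.card {i // g i = a} = Fintype.card {i // f i = a} := by
    simpa only [Multiset.count_map, Fintype.card_subtype, Finset.card_def, Finset.filter_val,
      eq_comm] using congrArg (Multiset.count a) h.symm
  let e (a : α) : {i // g i = a} ≃ {i // f i = a} := Fintype.equivOfCardEq (hcard a)
  exact ⟨Equiv.ofFiberEquiv e, Equiv.ofFiberEquiv_map e⟩

section TernaryCodes

variable {k n : ℕ} {C C' : Submodule (ZMod 3) (Fin n → ZMod 3)}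

lemma natCast_hammingNorm {ι : Type*} [Fintype ι] (x : ι → ZMod 3) :
    (hammingNorm x : ZMod 3) = x ⬝ᵥ x := by
  have hsq : ∀ a : ZMod 3, a * a = if a ≠ 0 then 1 else 0 := by decide
  simp_rw [dotProduct, hsq]
  exact Finset.natCast_card_filter _ _

lemma neg_one_pow_mul_eq_zero {a : Fin 2} {x : ZMod 3} : (-1) ^ (a : ℕ) * x = 0 ↔ x = 0 := by
  revert a x; decide

lemma hammingNorm_signedPerm (α : Fin n → Fin 2) (σ : Equiv.Perm (Fin n)) (x : Fin n → ZMod 3) :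
    hammingNorm (signedPerm α σ x) = hammingNorm x :=
  Finset.card_equiv σ fun i => by simp [signedPerm]

lemma signedPerm_injective (α : Fin n → Fin 2) (σ : Equiv.Perm (Fin n)) :
    Injective (signedPerm α σ) := by
  refine (injective_iff_map_eq_zero _).2 fun x hx => ?_
  rw [← hammingNorm_eq_zero, ← hammingNorm_signedPerm α σ, hx, hammingNorm_zero]

lemma exists_signedPerm_eq {x z : Fin n → ZMod 3} (h : hammingNorm x = hammingNorm z) :
    ∃ (α : Fin n → Fin 2) (σ : Equiv.Perm (Fin n)), signedPerm α σ x = z := by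
  obtain ⟨σ, hσ⟩ := Equiv.Perm.exists_map_finset_eq {i | z i ≠ 0} {i | x i ≠ 0} h.symm
  have hsupp (i : Fin n) : x (σ i) ≠ 0 ↔ z i ≠ 0 := by
    have := Finset.ext_iff.1 hσ (σ i)
    simpa only [Finset.mem_map_equiv, Equiv.symm_apply_apply, Finset.mem_filter, Finset.mem_univ,
      true_and, iff_comm] using this
  have hsign : ∀ a b : ZMod 3, (a ≠ 0 ↔ b ≠ 0) →
      (-1) ^ ((if a = b then 0 else 1 : Fin 2) : ℕ) * a = b := by decide
  exact ⟨fun i => if x (σ i) = z i then 0 else 1, σ, funext fun i => hsign _ _ (hsupp i)⟩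

lemma mem_codeOf {G : Matrix (Fin k) (Fin n) (ZMod 3)} {c : Fin n → ZMod 3} :
    c ∈ codeOf G ↔ ∃ a : Fin k → ZMod 3, ∑ r, a r • G r = c :=
  Submodule.mem_span_range_iff_exists_fun _

lemma CodeEquiv.refl (C : Submodule (ZMod 3) (Fin n → ZMod 3)) : CodeEquiv C C :=
  ⟨0, 1, by
    have h : signedPerm (n := n) 0 1 = LinearMap.id := by ext; simp [signedPerm]
    rw [h, Submodule.map_id]⟩

/-- The number of codewords of weight `w`; its invariance under `CodeEquiv` is what tells
inequivalent codes apart. -/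
noncomputable def weightCount (C : Submodule (ZMod 3) (Fin n → ZMod 3)) (w : ℕ) : ℕ :=
  {c | c ∈ C ∧ hammingNorm c = w}.ncard

lemma CodeEquiv.weightCount_eq (h : CodeEquiv C C') (w : ℕ) :
    weightCount C' w = weightCount C w := by
  obtain ⟨α, σ, rfl⟩ := h
  rw [weightCount, weightCount,
    ← Set.ncard_image_of_injective {c | c ∈ C ∧ _} (signedPerm_injective α σ)]
  congr 1
  ext c
  constructor
  · rintro ⟨⟨d, hd, rfl⟩, hw⟩
    exact ⟨d, ⟨hd, hammingNorm_signedPerm α σ d ▸ hw⟩, rfl⟩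
  · rintro ⟨d, ⟨hd, hw⟩, rfl⟩
    exact ⟨⟨d, hd, rfl⟩, (hammingNorm_signedPerm α σ d).trans hw⟩

lemma weightCount_codeOf {G : Matrix (Fin k) (Fin n) (ZMod 3)}
    (hG : LinearIndependent (ZMod 3) G.row) (w : ℕ) : weightCount (codeOf G) w =
      (Finset.univ.filter fun a : Fin k → ZMod 3 => hammingNorm (∑ r, a r • G r) = w).card := by
  have hinj : Injective fun a : Fin k → ZMod 3 => ∑ r, a r • G r :=
    hG.fintypeLinearCombination_injective
  rw [weightCount, ← Set.ncard_coe_finset, ← Set.ncard_image_of_injective _ hinj]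
  congr 1
  ext c
  simp only [Set.mem_ofPred_eq, mem_codeOf, Finset.coe_filter, Finset.mem_univ,
    true_and, Set.mem_image]
  constructor
  · rintro ⟨⟨a, rfl⟩, hw⟩
    exact ⟨a, hw, rfl⟩
  · rintro ⟨a, hw, rfl⟩
    exact ⟨⟨a, rfl⟩, hw⟩

lemma finrank_codeOf {G : Matrix (Fin k) (Fin n) (ZMod 3)} (hG : LinearIndependent (ZMod 3) G.row) :
    Module.finrank (ZMod 3) (codeOf G) = k :=
  (finrank_span_eq_card hG).trans (Fintype.card_fin k)

end TernaryCodes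

section Conditions

/-- The conditions (C1)–(C3) for a single vector. -/
def Admissible (c : Fin 12 → ZMod 3) : Prop :=
  (hammingNorm (xPart c) : ZMod 3) = yPart c 0 * yPart c 1 ∧
    (c ≠ 0 → 3 ≤ hammingNorm (xPart c)) ∧
    (hammingNorm (xPart c) = 3 → (yPart c 0, yPart c 1) ≠ (0, 0))

instance : DecidablePred Admissible := fun c => by unfold Admissible; infer_instance

/-- The codes to be classified, with the hypothesis `d = 4` dropped. -/
structure IsSZ (C : Submodule (ZMod 3) (Fin 12 → ZMod 3)) : Prop where
  finrank_eq : Module.finrank (ZMod 3) C = 5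
  admissible : ∀ c ∈ C, Admissible c

/-- The bilinear form on `𝔽₃¹²` whose quadratic form is, up to sign, the difference of the two
sides of (C1). -/
def szForm (c d : Fin 12 → ZMod 3) : ZMod 3 :=
  xPart c ⬝ᵥ xPart d + yPart c 0 * yPart d 1 + yPart c 1 * yPart d 0

variable {C C' : Submodule (ZMod 3) (Fin 12 → ZMod 3)} {c d : Fin 12 → ZMod 3}

lemma szConditions_iff : SZConditions C ↔ ∀ c ∈ C, Admissible c :=
  ⟨fun h c hc => ⟨h.c1 c hc, h.c2 c hc, h.c3 c hc⟩,
    fun h => ⟨fun c hc => (h c hc).1, fun c hc => (h c hc).2.1, fun c hc => (h c hc).2.2⟩⟩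

lemma Admissible.dotProduct_xPart (h : Admissible c) :
    xPart c ⬝ᵥ xPart c = yPart c 0 * yPart c 1 := by
  rw [← natCast_hammingNorm, h.1]

lemma Admissible.eq_zero (h : Admissible c) (hx : hammingNorm (xPart c) < 3) : c = 0 := by
  by_contra h0
  exact absurd (h.2.1 h0) (not_le.2 hx)

lemma szForm_eq_zero_of_admissible (hc : Admissible c) (hd : Admissible d)
    (hcd : Admissible (c + d)) : szForm c d = 0 := by
  have hadd := hcd.dotProduct_xPart
  simp only [map_add, Pi.add_apply, add_dotProduct, dotProduct_add, hc.dotProduct_xPart,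
    hd.dotProduct_xPart, dotProduct_comm (xPart d) (xPart c)] at hadd
  have hthree : (3 : ZMod 3) = 0 := rfl
  rw [szForm]
  linear_combination -hadd + (xPart c ⬝ᵥ xPart d) * hthree

lemma IsSZ.szForm_eq_zero (hC : IsSZ C) (hc : c ∈ C) (hd : d ∈ C) : szForm c d = 0 :=
  szForm_eq_zero_of_admissible (hC.admissible c hc) (hC.admissible d hd)
    (hC.admissible _ (C.add_mem hc hd))

lemma IsSZ.exists_vanishing (hC : IsSZ C) (k : Fin 4 → Fin 12) :
    ∃ c ∈ C, c ≠ 0 ∧ ∀ j, c (k j) = 0 := by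
  let f : C →ₗ[ZMod 3] (Fin 4 → ZMod 3) := (LinearMap.funLeft (ZMod 3) (ZMod 3) k).domRestrict C
  have hf : LinearMap.ker f ≠ ⊥ := LinearMap.ker_ne_bot_of_finrank_lt (by simp [hC.finrank_eq])
  obtain ⟨⟨c, hc⟩, hk, h0⟩ := Submodule.exists_mem_ne_zero_of_ne_bot hf
  exact ⟨c, hc, fun h => h0 (Subtype.ext h), fun j => congrFun (LinearMap.mem_ker.1 hk) j⟩

section szMap

variable (α : Fin 10 → Fin 2) (β : Fin 2) (σ : Equiv.Perm (Fin 10)) (τ : Equiv.Perm (Fin 2))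

lemma xPart_szMap (c : Fin 12 → ZMod 3) : xPart (szMap α β σ τ c) = signedPerm α σ (xPart c) := by
  ext i; simp [szMap, xPart, signedPerm]

lemma yPart_szMap (c : Fin 12 → ZMod 3) (j : Fin 2) :
    yPart (szMap α β σ τ c) j = (-1) ^ (β : ℕ) * yPart c (τ j) := by
  simp [szMap, yPart]

lemma eq_of_xPart_yPart (hx : xPart c = xPart d) (hy : ∀ j, yPart c j = yPart d j) : c = d :=
  funext <| Fin.addCases (m := 10) (n := 2) (congrFun hx) hy

lemma szMap_injective : Injective (szMap α β σ τ) := by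
  refine (injective_iff_map_eq_zero _).2 fun c hc => eq_of_xPart_yPart ?_ fun j => ?_
  · apply signedPerm_injective α σ
    rw [← xPart_szMap α β σ τ, hc, map_zero, map_zero]
  · have hj := yPart_szMap α β σ τ c (τ.symm j)
    rw [hc, map_zero, Pi.zero_apply, Equiv.apply_symm_apply, eq_comm,
      neg_one_pow_mul_eq_zero] at hj
    rw [hj, map_zero, Pi.zero_apply]

lemma Admissible.szMap (h : Admissible c) : Admissible (szMap α β σ τ c) := by
  have hmul : ∀ (y : Fin 2 → ZMod 3), (-1) ^ (β : ℕ) * y (τ 0) * ((-1) ^ (β : ℕ) * y (τ 1)) =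
      y 0 * y 1 := by
    revert β τ; decide +kernel
  have hzero : ∀ (y : Fin 2 → ZMod 3),
      ((-1) ^ (β : ℕ) * y (τ 0), (-1) ^ (β : ℕ) * y (τ 1)) = (0, 0) ↔ (y 0, y 1) = (0, 0) := by
    revert β τ; decide +kernel
  simp only [Admissible, xPart_szMap, yPart_szMap, hammingNorm_signedPerm, hmul, ne_eq, hzero]
  exact ⟨h.1, fun h0 => h.2.1 fun hc => h0 (by rw [hc, map_zero]), h.2.2⟩

end szMap

lemma IsSZ.of_szEquiv (hC : IsSZ C) (h : SZEquiv C C') : IsSZ C' := by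
  obtain ⟨α, β, σ, τ, rfl⟩ := h
  refine ⟨?_, ?_⟩
  · rw [← hC.finrank_eq]
    exact (C.equivMapOfInjective _ (szMap_injective α β σ τ)).finrank_eq.symm
  · rintro _ ⟨c, hc, rfl⟩
    exact (hC.admissible c hc).szMap α β σ τ

lemma SZEquiv.codeEquiv_pun (h : SZEquiv C C') : CodeEquiv (Pun C) (Pun C') := by
  obtain ⟨α, β, σ, τ, rfl⟩ := h
  refine ⟨α, σ, ?_⟩
  rw [Pun, Pun, ← Submodule.map_comp, ← Submodule.map_comp]
  exact congrArg (fun f => C.map f) (LinearMap.ext fun c => xPart_szMap α β σ τ c)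

end Conditions

section MinimumWeight

lemma hammingNorm_eq_add (c : Fin 12 → ZMod 3) :
    hammingNorm c = hammingNorm (xPart c) + hammingNorm (yPart c) := by
  simp only [hammingNorm, Finset.card_filter]
  exact Fin.sum_univ_add fun i : Fin (10 + 2) => if c i ≠ 0 then 1 else 0

variable {C : Submodule (ZMod 3) (Fin 12 → ZMod 3)}

lemma IsSZ.finrank_pun (hC : IsSZ C) : Module.finrank (ZMod 3) (Pun C) = 5 := by
  have hker (c : C) (hc : xPart.domRestrict C c = 0) : c = 0 := by
    have hx : xPart (c : Fin 12 → ZMod 3) = 0 := hc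
    exact Subtype.ext ((hC.admissible c c.2).eq_zero (by simp [hx]))
  rw [← hC.finrank_eq, ← LinearMap.finrank_range_of_inj ((injective_iff_map_eq_zero _).2 hker),
    LinearMap.range_domRestrict, Pun]

lemma Admissible.hammingNorm_eq_four {c : Fin 12 → ZMod 3} (h : Admissible c)
    (h3 : hammingNorm (xPart c) = 3) : hammingNorm c = 4 := by
  have hone : ∀ y : Fin 2 → ZMod 3, y 0 * y 1 = 0 → (y 0, y 1) ≠ (0, 0) → hammingNorm y = 1 := by
    decide
  have hprod : yPart c 0 * yPart c 1 = 0 := by rw [← h.1, h3]; rfl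
  rw [hammingNorm_eq_add, h3, hone _ hprod (h.2.2 h3)]

lemma Admissible.hammingNorm_xPart_of_eq_four {c : Fin 12 → ZMod 3} (h : Admissible c)
    (h4 : hammingNorm c = 4) : hammingNorm (xPart c) = 3 := by
  have hadd := hammingNorm_eq_add c
  have hc : c ≠ 0 := fun h0 => by rw [h0, hammingNorm_zero] at h4; omega
  have hge := h.2.1 hc
  by_contra hne
  have hx : hammingNorm (xPart c) = 4 := by omega
  have hy : yPart c = 0 := hammingNorm_eq_zero.1 (by omega)
  have h1 := h.1
  rw [hx, hy] at h1
  exact absurd h1 (by decide)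

lemma Admissible.four_le_hammingNorm {c : Fin 12 → ZMod 3} (h : Admissible c) (hc : c ≠ 0) :
    4 ≤ hammingNorm c := by
  obtain h3 | h3 := (h.2.1 hc).eq_or_lt
  · exact (h.hammingNorm_eq_four h3.symm).ge
  · exact (hammingNorm_eq_add c).ge.trans' (le_add_right h3)

lemma IsSZ.isTernaryCode (hC : IsSZ C) (h : ∃ c ∈ C, hammingNorm (xPart c) = 3) :
    IsTernaryCode C 5 4 := by
  obtain ⟨c, hc, h3⟩ := h
  have hc0 : xPart c ≠ 0 := hammingNorm_ne_zero_iff.1 (by omega)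
  refine ⟨hC.finrank_eq, ⟨c, hc, ?_, (hC.admissible c hc).hammingNorm_eq_four h3⟩, ?_⟩
  · rintro rfl
    exact hc0 (map_zero xPart)
  · rintro _ ⟨d, hd, hd0, rfl⟩
    exact (hC.admissible d hd).four_le_hammingNorm hd0

lemma IsSZ.isTernaryCode_pun (hC : IsSZ C) (h : ∃ c ∈ C, hammingNorm (xPart c) = 3) :
    IsTernaryCode (Pun C) 5 3 := by
  obtain ⟨c, hc, h3⟩ := h
  refine ⟨hC.finrank_pun, ⟨xPart c, ⟨c, hc, rfl⟩, hammingNorm_ne_zero_iff.1 (by omega), h3⟩, ?_⟩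
  rintro _ ⟨_, ⟨d, hd, rfl⟩, hd0, rfl⟩
  exact (hC.admissible d hd).2.1 fun h => hd0 (by rw [h, map_zero])

lemma SZConditions.isSZ (h : SZConditions C) (hC : IsTernaryCode C 5 4) : IsSZ C :=
  ⟨hC.1, szConditions_iff.1 h⟩

lemma IsSZ.exists_hammingNorm_xPart_eq_three (hC : IsSZ C) (h : IsTernaryCode C 5 4) :
    ∃ c ∈ C, hammingNorm (xPart c) = 3 := by
  obtain ⟨c, hc, -, h4⟩ := h.2.1
  exact ⟨c, hc, (hC.admissible c hc).hammingNorm_xPart_of_eq_four h4⟩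

end MinimumWeight

section Containment

variable {C : Submodule (ZMod 3) (Fin 12 → ZMod 3)} {k l : ℕ}

/-- Some code SZ-equivalent to `C` contains all the words `g j`. The classification brings `C` into
normal form by containments of longer and longer lists of words. -/
def SZContains (C : Submodule (ZMod 3) (Fin 12 → ZMod 3)) (g : Fin k → Fin 12 → ZMod 3) : Prop :=
  ∃ C', SZEquiv C C' ∧ ∀ j, g j ∈ C'

lemma forall_vecCons_mem {v : Fin 12 → ZMod 3} {g : Fin k → Fin 12 → ZMod 3} :
    (∀ j, Matrix.vecCons v g j ∈ C) ↔ v ∈ C ∧ ∀ j, g j ∈ C :=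
  Fin.forall_fin_succ

lemma szContains_of_szMap {g : Fin k → Fin 12 → ZMod 3} (hg : ∀ j, g j ∈ C) (α : Fin 10 → Fin 2)
    (β : Fin 2) (σ : Equiv.Perm (Fin 10)) (τ : Equiv.Perm (Fin 2)) :
    SZContains C fun j => szMap α β σ τ (g j) :=
  ⟨_, ⟨α, β, σ, τ, rfl⟩, fun j => Submodule.mem_map_of_mem (hg j)⟩

lemma SZContains.exists_trans {ι : Type*} {g : Fin k → Fin 12 → ZMod 3}
    {g' : ι → Fin l → Fin 12 → ZMod 3} (hC : IsSZ C) (h : SZContains C g)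
    (h' : ∀ C', IsSZ C' → (∀ j, g j ∈ C') → ∃ i, SZContains C' (g' i)) :
    ∃ i, SZContains C (g' i) := by
  obtain ⟨C', hCC', hg⟩ := h
  obtain ⟨i, C'', hCC'', hmem⟩ := h' C' (hC.of_szEquiv hCC') hg
  exact ⟨i, C'', szEquiv_equivalence.trans hCC' hCC'', hmem⟩

/-- The columns of the matrix with rows `xPart (g j)`, the `i`-th one multiplied by
`(-1) ^ α i`. -/
def signedColumns (α : Fin 10 → Fin 2) (g : Fin k → Fin 12 → ZMod 3) :
    Multiset (Fin k → ZMod 3) :=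
  Finset.univ.val.map fun i j => (-1) ^ (α i : ℕ) * xPart (g j) i

/-- Up to the signs `α`, the generator matrices with rows `g j` and `g' j` have the same first ten
columns, in any order, and the last two columns correspond under `τ`. -/
def ColumnsAgree (α : Fin 10 → Fin 2) (τ : Equiv.Perm (Fin 2)) (g g' : Fin k → Fin 12 → ZMod 3) :
    Prop :=
  signedColumns α g = signedColumns 0 g' ∧ ∀ j b, yPart (g j) (τ b) = yPart (g' j) b

instance (α : Fin 10 → Fin 2) (τ : Equiv.Perm (Fin 2)) (g g' : Fin k → Fin 12 → ZMod 3) :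
    Decidable (ColumnsAgree α τ g g') := by unfold ColumnsAgree; infer_instance

lemma ColumnsAgree.szContains {g g' : Fin k → Fin 12 → ZMod 3} {α : Fin 10 → Fin 2}
    {τ : Equiv.Perm (Fin 2)} (h : ColumnsAgree α τ g g') (hg : ∀ j, g j ∈ C) :
    SZContains C g' := by
  obtain ⟨σ, hσ⟩ := exists_perm_of_map_univ_val_eq h.1
  have hmap : (fun j => szMap (α ∘ σ) 0 σ τ (g j)) = g' := by
    funext j
    refine eq_of_xPart_yPart (funext fun i => ?_) fun b => ?_
    · rw [xPart_szMap]
      simpa [signedPerm] using congrFun (hσ i) j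
    · simpa [yPart_szMap] using h.2 j b
  exact hmap ▸ szContains_of_szMap hg (α ∘ σ) 0 σ τ

end Containment

section Frames

/-- A word with `wt x = 3`, in normal form. -/
def block₁ : Fin 12 → ZMod 3 := ![1, 1, 1, 0, 0, 0, 0, 0, 0, 0, 1, 0]

/-- A word with `x`-support of size 6 disjoint from that of `block₁`, in normal form. -/
def sixOnes : Fin 12 → ZMod 3 := ![0, 0, 0, 1, 1, 1, 1, 1, 1, 0, 0, 0]

variable {C : Submodule (ZMod 3) (Fin 12 → ZMod 3)}

lemma IsSZ.szContains_block₁ (hC : IsSZ C) {c : Fin 12 → ZMod 3} (hc : c ∈ C)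
    (h3 : hammingNorm (xPart c) = 3) : SZContains C ![block₁] := by
  obtain ⟨h1, -, hy⟩ := hC.admissible c hc
  obtain ⟨α, σ, hx⟩ := exists_signedPerm_eq (z := xPart block₁) (h3.trans (by decide))
  have hnormal : ∀ y : Fin 2 → ZMod 3, y 0 * y 1 = 0 → (y 0, y 1) ≠ (0, 0) →
      ∃ (β : Fin 2) (τ : Equiv.Perm (Fin 2)), ∀ b, (-1) ^ (β : ℕ) * y (τ b) = yPart block₁ b := by
    decide +kernel
  have hprod : yPart c 0 * yPart c 1 = 0 := by rw [← h1, h3]; rfl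
  obtain ⟨β, τ, hβτ⟩ := hnormal (yPart c) hprod (hy h3)
  have hmap : (fun j => szMap α β σ τ (![c] j)) = ![block₁] := by
    funext j
    rw [Matrix.cons_val_fin_one, Matrix.cons_val_fin_one]
    exact eq_of_xPart_yPart (by rw [xPart_szMap, hx]) fun b => by rw [yPart_szMap, hβτ]
  exact hmap ▸ szContains_of_szMap (by simpa using hc) α β σ τ

lemma szContains_sixOnes_of_support {v : Fin 12 → ZMod 3} (hg : ∀ j, ![block₁, v] j ∈ C)
    {i₀ : Fin 10} (hi₀ : 3 ≤ i₀) (hx : ∀ i, xPart v i = 0 ↔ i < 3 ∨ i = i₀)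
    (hy : ∀ b, yPart v b = 0) : SZContains C ![block₁, sixOnes] := by
  have hcolumn : ∀ (i₀ i : Fin 10) (a : ZMod 3), (a = 0 ↔ i < 3 ∨ i = i₀) → ∀ j,
      (-1) ^ ((if a = 2 then 1 else 0 : Fin 2) : ℕ) * (![xPart block₁ i, a] j : ZMod 3) =
        ![if i < 3 then 1 else 0, if i < 3 ∨ i = i₀ then 0 else 1] j := by
    decide +kernel
  have hcolumns : ∀ i₀ : Fin 10, 3 ≤ i₀ → Finset.univ.val.map (fun i : Fin 10 =>
      (![if i < 3 then 1 else 0, if i < 3 ∨ i = i₀ then 0 else 1] : Fin 2 → ZMod 3)) =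
        signedColumns 0 ![block₁, sixOnes] := by
    decide +kernel
  refine ColumnsAgree.szContains (α := fun i => if xPart v i = 2 then 1 else 0) (τ := 1)
    ⟨Eq.trans ?_ (hcolumns i₀ hi₀), fun j b => ?_⟩ hg
  · refine Multiset.map_congr rfl fun i _ => funext fun j => ?_
    rw [← hcolumn i₀ i _ (hx i) j]
    fin_cases j <;> rfl
  · revert j
    exact Fin.forall_fin_two.2 ⟨rfl, (hy b).trans (by revert b; decide)⟩

lemma IsSZ.szContains_sixOnes (hC : IsSZ C) (hg : ∀ j, ![block₁] j ∈ C) :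
    SZContains C ![block₁, sixOnes] := by
  obtain ⟨v, hv, h0, hk⟩ := hC.exists_vanishing ![0, 1, 2, 10]
  have hv0 : v 0 = 0 := hk 0
  have hv1 : v 1 = 0 := hk 1
  have hv2 : v 2 = 0 := hk 2
  have hv10 : v 10 = 0 := hk 3
  have hv11 : v 11 = 0 := by
    simpa [szForm, xPart, yPart, block₁, dotProduct, Fin.sum_univ_succ, hv0, hv1, hv2] using
      hC.szForm_eq_zero (hg 0) hv
  have hy : ∀ b, yPart v b = 0 := Fin.forall_fin_two.2 ⟨hv10, hv11⟩
  obtain ⟨h1, h2, h3⟩ := hC.admissible v hv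
  let Z : Finset (Fin 10) := {i | xPart v i = 0}
  have hsub : Finset.Iio 3 ⊆ Z := fun i hi => by
    have hlt : ∀ i ∈ Finset.Iio (3 : Fin 10), i = 0 ∨ i = 1 ∨ i = 2 := by decide
    obtain rfl | rfl | rfl := hlt i hi <;> rw [Finset.mem_filter_univ] <;> assumption
  have hcard : Z.card = 4 := by
    have hsum : Z.card + hammingNorm (xPart v) = 10 :=
      Finset.card_filter_add_card_filter_not (s := Finset.univ) fun i => xPart v i = 0
    have hle : 3 ≤ Z.card := Finset.card_le_card hsub
    have hdvd : 3 ∣ hammingNorm (xPart v) := by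
      rw [← ZMod.natCast_eq_zero_iff, h1, hy, zero_mul]
    have hne : hammingNorm (xPart v) ≠ 3 := fun h => h3 h (by rw [hy, hy])
    have := h2 h0
    omega
  obtain ⟨i₀, hi₀, hZ⟩ := Finset.exists_eq_insert_iff.2 ⟨hsub, by rw [hcard, Fin.card_Iio]; rfl⟩
  refine szContains_sixOnes_of_support (v := v) (i₀ := i₀) ?_ ?_ (fun i => ?_) hy
  · simpa only [forall_vecCons_mem] using ⟨hg 0, hv, nofun⟩
  · exact not_lt.1 fun h => hi₀ (Finset.mem_Iio.2 h)
  · rw [or_comm, ← Finset.mem_Iio, ← Finset.mem_insert, hZ, Finset.mem_filter_univ]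

/-- A word vanishing on the support of `block₁`, with entries `s` above those of `sixOnes`. -/
def sixWord (s : Fin 6 → ZMod 3) (p y : ZMod 3) : Fin 12 → ZMod 3 :=
  ![0, 0, 0, s 0, s 1, s 2, s 3, s 4, s 5, p, y, 0]

lemma signedColumns_sixWord (s : Fin 6 → ZMod 3) (p y : ZMod 3) :
    signedColumns 0 ![block₁, sixOnes, sixWord s p y] =
      3 • {![1, 0, 0]} + (Finset.univ.val.map s).map (fun a => ![0, 1, a]) + {![0, 0, p]} := by
  have hcolumn (i : Fin 10) :
      (fun j => (-1) ^ ((0 : Fin 10 → Fin 2) i : ℕ) *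
        xPart (![block₁, sixOnes, sixWord s p y] j) i) =
      ![![1, 0, 0], ![1, 0, 0], ![1, 0, 0], ![0, 1, s 0], ![0, 1, s 1], ![0, 1, s 2],
        ![0, 1, s 3], ![0, 1, s 4], ![0, 1, s 5], ![0, 0, p]] i := by
    funext j
    refine (one_mul _).trans ?_
    fin_cases i <;> fin_cases j <;> rfl
  simp only [signedColumns, hcolumn]
  rfl

-- Let `m₀, m₁, m₂` be the multiplicities of `0, 1, 2` among the six entries. Their sum is 6, and
-- the entries and their squares have sums `0` and `-p²`, so all three are congruent to `p²` modulo
-- 3. Hence they are `3, 3, 0` if `p = 0` and `4, 1, 1` otherwise, in some order, and adding a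
-- constant makes `0` the most frequent entry.
set_option synthInstance.maxSize 1000 in
set_option maxRecDepth 100000 in
lemma exists_add_const_map_eq : ∀ a b c d p : ZMod 3,
    a * a + b * b + c * c + d * d + (a + b + c + d) * (a + b + c + d) + p * p = 0 →
    (a, b, c, d, p) ≠ 0 →
    ∃ k : ZMod 3,
      (p ≠ 0 ∧ Finset.univ.val.map (![0, a, b, c, d, -(a + b + c + d)] + fun _ => k) =
        Finset.univ.val.map ![1, -1, 0, 0, 0, 0]) ∨
      (p = 0 ∧ ∃ e ≠ 0, Finset.univ.val.map (![0, a, b, c, d, -(a + b + c + d)] + fun _ => k) =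
        Finset.univ.val.map ![e, e, e, 0, 0, 0]) := by
  decide +kernel

lemma yPart_sixWord (s : Fin 6 → ZMod 3) (p y : ZMod 3) : yPart (sixWord s p y) = ![y, 0] := by
  funext b
  fin_cases b <;> rfl

lemma dotProduct_sixWord (a b c d p y : ZMod 3) :
    xPart (sixWord ![0, a, b, c, d, -(a + b + c + d)] p y) ⬝ᵥ
        xPart (sixWord ![0, a, b, c, d, -(a + b + c + d)] p y) =
      a * a + b * b + c * c + d * d + (a + b + c + d) * (a + b + c + d) + p * p := by
  simp only [dotProduct, xPart, sixWord, neg_add_rev, Matrix.cons_val_zero, Matrix.cons_val_one,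
    Matrix.cons_val, LinearMap.coe_mk, AddHom.coe_mk, Fin.sum_univ_succ, Fin.sum_univ_zero,
    Fin.succ_zero_eq_one, Fin.succ_one_eq_two, Fin.reduceCastAdd, Fin.reduceSucc]
  ring

lemma szContains_sixWord_of_map_eq {s t : Fin 6 → ZMod 3} {p y : ZMod 3}
    (hg : ∀ j, ![block₁, sixOnes, sixWord s p y] j ∈ C)
    (hst : Finset.univ.val.map s = Finset.univ.val.map t) :
    SZContains C ![block₁, sixOnes, sixWord t p y] := by
  have hx : signedColumns 0 ![block₁, sixOnes, sixWord s p y] =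
      signedColumns 0 ![block₁, sixOnes, sixWord t p y] := by
    rw [signedColumns_sixWord, signedColumns_sixWord, hst]
  have hy : ∀ j, yPart (![block₁, sixOnes, sixWord s p y] j) =
      yPart (![block₁, sixOnes, sixWord t p y] j) := by
    simp [Fin.forall_fin_succ, yPart_sixWord]
  exact ColumnsAgree.szContains (τ := 1) ⟨hx, fun j b => congrFun (hy j) b⟩ hg

lemma eq_vecCons_apply (v : Fin 12 → ZMod 3) :
    v = ![v 0, v 1, v 2, v 3, v 4, v 5, v 6, v 7, v 8, v 9, v 10, v 11] :=
  (FinVec.etaExpand_eq v).symm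

lemma Admissible.sixWord_ne_zero {a b c d p y : ZMod 3}
    (h : Admissible (sixWord ![0, a, b, c, d, -(a + b + c + d)] p y))
    (hne : sixWord ![0, a, b, c, d, -(a + b + c + d)] p y ≠ 0) : (a, b, c, d, p) ≠ 0 := by
  intro h0
  simp only [Prod.mk_eq_zero] at h0
  obtain ⟨rfl, rfl, rfl, rfl, rfl⟩ := h0
  revert y
  decide +kernel

lemma IsSZ.exists_sixWord_mem (hC : IsSZ C) (hg : ∀ j, ![block₁, sixOnes] j ∈ C) :
    ∃ a b c d p y, sixWord ![0, a, b, c, d, -(a + b + c + d)] p y ∈ C ∧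
      (a, b, c, d, p) ≠ 0 := by
  obtain ⟨v, hv, hne, hk⟩ := hC.exists_vanishing ![0, 1, 2, 3]
  have hv0 : v 0 = 0 := hk 0
  have hv1 : v 1 = 0 := hk 1
  have hv2 : v 2 = 0 := hk 2
  have hv3 : v 3 = 0 := hk 3
  have hv11 : v 11 = 0 := by
    simpa [szForm, xPart, yPart, block₁, dotProduct, Fin.sum_univ_succ, hv0, hv1, hv2] using
      hC.szForm_eq_zero (hg 0) hv
  have hv8 : v 8 = -(v 4 + v 5 + v 6 + v 7) := by
    have h : v 4 + (v 5 + (v 6 + (v 7 + v 8))) = 0 := by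
      simpa [szForm, xPart, yPart, sixOnes, dotProduct, Fin.sum_univ_succ, hv3] using
        hC.szForm_eq_zero (hg 1) hv
    linear_combination h
  have hvw : v = sixWord ![0, v 4, v 5, v 6, v 7, -(v 4 + v 5 + v 6 + v 7)] (v 9) (v 10) := by
    have h := eq_vecCons_apply v
    rwa [hv0, hv1, hv2, hv3, hv8, hv11] at h
  exact ⟨_, _, _, _, _, _, hvw ▸ hv,
    Admissible.sixWord_ne_zero (hvw ▸ hC.admissible v hv) (hvw ▸ hne)⟩

lemma sixWord_add_const (s : Fin 6 → ZMod 3) (p y k : ZMod 3) :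
    sixWord s p y + k • sixOnes = sixWord (s + fun _ => k) p y := by
  funext i
  fin_cases i <;> simp [sixWord, sixOnes]

lemma IsSZ.szContains_sixWord (hC : IsSZ C) (hg : ∀ j, ![block₁, sixOnes] j ∈ C) :
    ∃ y, (∃ p ≠ 0, SZContains C ![block₁, sixOnes, sixWord ![1, -1, 0, 0, 0, 0] p y]) ∨
      ∃ e ≠ 0, SZContains C ![block₁, sixOnes, sixWord ![e, e, e, 0, 0, 0] 0 y] := by
  obtain ⟨a, b, c, d, p, y, hv, hne⟩ := hC.exists_sixWord_mem hg
  have hsq := (hC.admissible _ hv).dotProduct_xPart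
  rw [dotProduct_sixWord, yPart_sixWord] at hsq
  obtain ⟨hblock, hsix, -⟩ := by simpa only [forall_vecCons_mem] using hg
  have hadd (k) {t} (h : Finset.univ.val.map (![0, a, b, c, d, -(a + b + c + d)] + fun _ => k) =
      Finset.univ.val.map t) : SZContains C ![block₁, sixOnes, sixWord t p y] := by
    have hvk := C.add_mem hv (C.smul_mem k hsix)
    rw [sixWord_add_const] at hvk
    refine szContains_sixWord_of_map_eq ?_ h
    simpa only [forall_vecCons_mem] using ⟨hblock, hsix, hvk, nofun⟩
  obtain ⟨k, ⟨hp, h⟩ | ⟨rfl, e, he, h⟩⟩ := exists_add_const_map_eq a b c d p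
    (hsq.trans (mul_zero y)) hne
  · exact ⟨y, .inl ⟨p, hp, hadd k h⟩⟩
  · exact ⟨y, .inr ⟨e, he, hadd k h⟩⟩

/-- The word with `x`-support `{3, 4, 5}` in a frame of three disjoint words with `wt x = 3`. -/
def block₂ : Fin 12 → ZMod 3 := ![0, 0, 0, 1, 1, 1, 0, 0, 0, 0, 1, 0]

/-- The word with `x`-support `{6, 7, 8}` in a frame of three disjoint words with `wt x = 3`. -/
def block₃ : Fin 12 → ZMod 3 := ![0, 0, 0, 0, 0, 0, 1, 1, 1, 0, 1, 0]

lemma IsSZ.szContains_blocks (hC : IsSZ C) {e y : ZMod 3} (he : e ≠ 0)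
    (hg : ∀ j, ![block₁, sixOnes, sixWord ![e, e, e, 0, 0, 0] 0 y] j ∈ C) :
    SZContains C ![block₁, block₂, block₃] := by
  have hy : y ≠ 0 := by
    have h : ∀ e y : ZMod 3, e ≠ 0 → Admissible (sixWord ![e, e, e, 0, 0, 0] 0 y) → y ≠ 0 := by
      decide +kernel
    exact h e y he (hC.admissible _ (hg 2))
  have hsigns : ∀ e y : ZMod 3, e ≠ 0 → y ≠ 0 →
      ColumnsAgree (if e * y = 1 then ![0, 0, 0, 0, 0, 0, 1, 1, 1, 0]
          else ![0, 0, 0, 1, 1, 1, 0, 0, 0, 0]) 1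
        ![block₁, y • sixWord ![e, e, e, 0, 0, 0] 0 y,
          -(e * y) • (sixOnes - e • sixWord ![e, e, e, 0, 0, 0] 0 y)]
        ![block₁, block₂, block₃] := by
    decide +kernel
  obtain ⟨hblock, hsix, hu, -⟩ := by simpa only [forall_vecCons_mem] using hg
  have hw := C.smul_mem (-(e * y)) (C.sub_mem hsix (C.smul_mem e hu))
  exact (hsigns e y he hy).szContains
    (by simpa only [forall_vecCons_mem] using ⟨hblock, C.smul_mem y hu, hw, nofun⟩)

/-- In a frame without three disjoint words with `wt x = 3`, a word whose `x`-support is disjoint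
from that of `block₁`. -/
def block₂' : Fin 12 → ZMod 3 := ![0, 0, 0, 1, 1, 0, 0, 0, 0, 1, 1, 0]

/-- The word of the frame with `block₂'` that `sixOnes` becomes when `block₂'` is normalised. -/
def glue₂ : Fin 12 → ZMod 3 := ![0, 0, 0, 1, 2, 1, 1, 1, 1, 0, 0, 0]

lemma IsSZ.szContains_block₂' (hC : IsSZ C) {p y : ZMod 3} (hp : p ≠ 0)
    (hg : ∀ j, ![block₁, sixOnes, sixWord ![1, -1, 0, 0, 0, 0] p y] j ∈ C) :
    SZContains C ![block₁, block₂', glue₂] := by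
  have hy : y ≠ 0 := by
    have h : ∀ p y : ZMod 3, p ≠ 0 → Admissible (sixWord ![1, -1, 0, 0, 0, 0] p y) → y ≠ 0 := by
      decide +kernel
    exact h p y hp (hC.admissible _ (hg 2))
  have hsigns : ∀ p y : ZMod 3, p ≠ 0 → y ≠ 0 →
      ColumnsAgree ![0, 0, 0, if y = 2 then 1 else 0, if y = 2 then 0 else 1, 0, 0, 0, 0,
          if p = y then 0 else 1] 1
        ![block₁, y • sixWord ![1, -1, 0, 0, 0, 0] p y, sixOnes] ![block₁, block₂', glue₂] := by
    decide +kernel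
  obtain ⟨hblock, hsix, hu, -⟩ := by simpa only [forall_vecCons_mem] using hg
  exact (hsigns p y hp hy).szContains
    (by simpa only [forall_vecCons_mem] using ⟨hblock, C.smul_mem y hu, hsix, nofun⟩)

/-- A word orthogonal to the three blocks and vanishing at the first coordinate of each of them. -/
def glueWord (s t u p y : ZMod 3) : Fin 12 → ZMod 3 := ![0, s, -s, 0, t, -t, 0, u, -u, p, y, 0]

lemma IsSZ.exists_glueWord_mem (hC : IsSZ C) (hg : ∀ j, ![block₁, block₂, block₃] j ∈ C) :
    ∃ s t u p y, glueWord s t u p y ∈ C ∧ glueWord s t u p y ≠ 0 := by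
  obtain ⟨v, hv, hne, hk⟩ := hC.exists_vanishing ![0, 3, 6, 11]
  have hv0 : v 0 = 0 := hk 0
  have hv3 : v 3 = 0 := hk 1
  have hv6 : v 6 = 0 := hk 2
  have hv11 : v 11 = 0 := hk 3
  have hv2 : v 2 = -v 1 := by
    have h : v 1 + v 2 = 0 := by
      simpa [szForm, xPart, yPart, block₁, dotProduct, Fin.sum_univ_succ, hv0, hv11] using
        hC.szForm_eq_zero (hg 0) hv
    linear_combination h
  have hv5 : v 5 = -v 4 := by
    have h : v 4 + v 5 = 0 := by
      simpa [szForm, xPart, yPart, block₂, dotProduct, Fin.sum_univ_succ, hv3, hv11] using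
        hC.szForm_eq_zero (hg 1) hv
    linear_combination h
  have hv8 : v 8 = -v 7 := by
    have h : v 7 + v 8 = 0 := by
      simpa [szForm, xPart, yPart, block₃, dotProduct, Fin.sum_univ_succ, hv6, hv11] using
        hC.szForm_eq_zero (hg 2) hv
    linear_combination h
  have hvw := eq_vecCons_apply v
  rw [hv0, hv2, hv3, hv5, hv6, hv8, hv11] at hvw
  exact ⟨_, _, _, _, _, hvw ▸ hv, hvw ▸ hne⟩

-- By (C1) and (C2), either none or exactly two of `s, t, u` vanish. In the second case (C3) fails
-- for `v - y • b` with `b` the block whose coordinates carry the nonzero one.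
lemma glueWord_ne_zero : ∀ s t u p y : ZMod 3, glueWord s t u p y ≠ 0 →
    Admissible (glueWord s t u p y) → Admissible (glueWord s t u p y - y • block₁) →
    Admissible (glueWord s t u p y - y • block₂) → Admissible (glueWord s t u p y - y • block₃) →
    (s ≠ 0 ∧ t ≠ 0 ∧ u ≠ 0) ∧ p = 0 := by
  decide +kernel

lemma columnsAgree_glueWord : ∀ s t u y : ZMod 3, s ≠ 0 ∧ t ≠ 0 ∧ u ≠ 0 →
    ColumnsAgree 0 1 ![block₁, block₂, block₃, glueWord s t u 0 y - y • block₁]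
      ![block₁, block₂, block₃, glueWord 1 1 1 0 0] := by
  decide +kernel

lemma IsSZ.szContains_glueWord (hC : IsSZ C) (hg : ∀ j, ![block₁, block₂, block₃] j ∈ C) :
    SZContains C ![block₁, block₂, block₃, glueWord 1 1 1 0 0] := by
  obtain ⟨s, t, u, p, y, hv, hne⟩ := hC.exists_glueWord_mem hg
  obtain ⟨hb₁, hb₂, hb₃, -⟩ := by simpa only [forall_vecCons_mem] using hg
  have hsub {b} (hb : b ∈ C) := C.sub_mem hv (C.smul_mem y hb)
  obtain ⟨hstu, rfl⟩ := glueWord_ne_zero s t u p y hne (hC.admissible _ hv)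
    (hC.admissible _ (hsub hb₁)) (hC.admissible _ (hsub hb₂)) (hC.admissible _ (hsub hb₃))
  exact (columnsAgree_glueWord s t u y hstu).szContains
    (by simpa only [forall_vecCons_mem] using ⟨hb₁, hb₂, hb₃, hsub hb₁, nofun⟩)

/-- A word orthogonal to the three blocks and to the glue word, with zeros at the second coordinate
of every block and at the third coordinate of the first. -/
def lastWord (e p y₁ y₂ : ZMod 3) : Fin 12 → ZMod 3 :=
  ![-y₂, 0, 0, -e - y₂, 0, e, e - y₂, 0, -e, p, y₁, y₂]

lemma IsSZ.exists_lastWord_mem (hC : IsSZ C)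
    (hg : ∀ j, ![block₁, block₂, block₃, glueWord 1 1 1 0 0] j ∈ C) :
    ∃ e p y₁ y₂, lastWord e p y₁ y₂ ∈ C ∧ lastWord e p y₁ y₂ ≠ 0 := by
  obtain ⟨v, hv, hne, hk⟩ := hC.exists_vanishing ![1, 2, 4, 7]
  have hv1 : v 1 = 0 := hk 0
  have hv2 : v 2 = 0 := hk 1
  have hv4 : v 4 = 0 := hk 2
  have hv7 : v 7 = 0 := hk 3
  have h₁ : v 0 + v 11 = 0 := by
    simpa [szForm, xPart, yPart, block₁, dotProduct, Fin.sum_univ_succ, hv1, hv2] using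
      hC.szForm_eq_zero (hg 0) hv
  have h₂ : v 3 + v 5 + v 11 = 0 := by
    simpa [szForm, xPart, yPart, block₂, dotProduct, Fin.sum_univ_succ, hv4] using
      hC.szForm_eq_zero (hg 1) hv
  have h₃ : v 6 + v 8 + v 11 = 0 := by
    simpa [szForm, xPart, yPart, block₃, dotProduct, Fin.sum_univ_succ, hv7] using
      hC.szForm_eq_zero (hg 2) hv
  have h₄ : -v 5 + -v 8 = 0 := by
    simpa [szForm, xPart, yPart, glueWord, dotProduct, Fin.sum_univ_succ, hv1, hv2, hv4, hv7] using
      hC.szForm_eq_zero (hg 3) hv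
  have hv0 : v 0 = -v 11 := by linear_combination h₁
  have hv3 : v 3 = -v 5 - v 11 := by linear_combination h₂
  have hv6 : v 6 = v 5 - v 11 := by linear_combination h₃ + h₄
  have hv8 : v 8 = -v 5 := by linear_combination -h₄
  have hvw := eq_vecCons_apply v
  rw [hv0, hv1, hv2, hv3, hv4, hv6, hv7, hv8] at hvw
  exact ⟨_, _, _, _, hvw ▸ hv, hvw ▸ hne⟩

-- (C1) reads `e² + p² = y₁ y₂`. Hence `y₂ ≠ 0`, and with `y₂ = 1` the multiples of the blocks turn
-- `e` into `0`.
lemma columnsAgree_lastWord : ∀ e p y₁ y₂ : ZMod 3, lastWord e p y₁ y₂ ≠ 0 →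
    Admissible (lastWord e p y₁ y₂) →
    ColumnsAgree ![0, 0, 0, 0, 0, 0, 0, 0, 0, if p = -y₂ then 1 else 0] 1
      ![block₁, block₂, block₃, glueWord 1 1 1 0 0 - (y₂ * e) • block₂ + (y₂ * e) • block₃,
        y₂ • lastWord e p y₁ y₂ + (e * e + y₂ * e) • block₂ + (e * e - y₂ * e) • block₃]
      ![block₁, block₂, block₃, glueWord 1 1 1 0 0, lastWord 0 (p * p) (p * p) 1] := by
  decide +kernel

lemma IsSZ.szContains_lastWord (hC : IsSZ C)
    (hg : ∀ j, ![block₁, block₂, block₃, glueWord 1 1 1 0 0] j ∈ C) :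
    ∃ p : ZMod 3, SZContains C
      ![block₁, block₂, block₃, glueWord 1 1 1 0 0, lastWord 0 (p * p) (p * p) 1] := by
  obtain ⟨e, p, y₁, y₂, hv, hne⟩ := hC.exists_lastWord_mem hg
  obtain ⟨hb₁, hb₂, hb₃, hglue, -⟩ := by simpa only [forall_vecCons_mem] using hg
  have hadd {w} (hw : w ∈ C) (a b : ZMod 3) : w + a • block₂ + b • block₃ ∈ C :=
    C.add_mem (C.add_mem hw (C.smul_mem a hb₂)) (C.smul_mem b hb₃)
  have hglue' := hadd hglue (-(y₂ * e)) (y₂ * e)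
  rw [neg_smul, ← sub_eq_add_neg] at hglue'
  exact ⟨p, (columnsAgree_lastWord e p y₁ y₂ hne (hC.admissible _ hv)).szContains
    (by simpa only [forall_vecCons_mem] using
      ⟨hb₁, hb₂, hb₃, hglue', hadd (C.smul_mem y₂ hv) _ _, nofun⟩)⟩

/-- A word orthogonal to `block₁`, `block₂'` and `glue₂` and vanishing at `0, 3, 4`. -/
def glueWord' (s p q r y : ZMod 3) : Fin 12 → ZMod 3 :=
  ![0, s, -s, 0, 0, p, q, r, -(p + q + r), 0, y, 0]

/-- The word that `glueWord'` becomes in the normal form. -/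
def glue₁ : Fin 12 → ZMod 3 := ![0, 1, 2, 0, 0, 1, 1, 2, 2, 0, 0, 0]

lemma IsSZ.exists_glueWord'_mem (hC : IsSZ C) (hg : ∀ j, ![block₁, block₂', glue₂] j ∈ C) :
    ∃ s p q r y, glueWord' s p q r y ∈ C ∧ glueWord' s p q r y ≠ 0 := by
  obtain ⟨v, hv, hne, hk⟩ := hC.exists_vanishing ![0, 3, 4, 11]
  have hv0 : v 0 = 0 := hk 0
  have hv3 : v 3 = 0 := hk 1
  have hv4 : v 4 = 0 := hk 2
  have hv11 : v 11 = 0 := hk 3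
  have hv2 : v 2 = -v 1 := by
    have h : v 1 + v 2 = 0 := by
      simpa [szForm, xPart, yPart, block₁, dotProduct, Fin.sum_univ_succ, hv0, hv11] using
        hC.szForm_eq_zero (hg 0) hv
    linear_combination h
  have hv9 : v 9 = 0 := by
    simpa [szForm, xPart, yPart, block₂', dotProduct, Fin.sum_univ_succ, hv3, hv4, hv11] using
      hC.szForm_eq_zero (hg 1) hv
  have hv8 : v 8 = -(v 5 + v 6 + v 7) := by
    have h : v 5 + (v 6 + (v 7 + v 8)) = 0 := by
      simpa [szForm, xPart, yPart, glue₂, dotProduct, Fin.sum_univ_succ, hv3, hv4] using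
        hC.szForm_eq_zero (hg 2) hv
    linear_combination h
  have hvw := eq_vecCons_apply v
  rw [hv0, hv2, hv3, hv4, hv8, hv9, hv11] at hvw
  exact ⟨_, _, _, _, _, hvw ▸ hv, hvw ▸ hne⟩

-- By (C1) the number of nonzero entries among `p, q, r, -(p + q + r)` is `s²` modulo 3, so it is 4
-- if `s ≠ 0`. If `s = 0`, these entries are `e, e, e, 0` in some order with `e ≠ 0`, and (C3) fails
-- for `v - y • block₂' - e • glue₂`.
lemma glueWord'_ne_zero : ∀ s p q r y : ZMod 3, glueWord' s p q r y ≠ 0 →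
    Admissible (glueWord' s p q r y) →
    Admissible (glueWord' s p q r y - y • block₂' + glue₂) →
    Admissible (glueWord' s p q r y - y • block₂' - glue₂) →
    s * p * q * r * (p + q + r) ≠ 0 := by
  decide +kernel

lemma columnsAgree_glueWord' : ∀ s p q r y : ZMod 3,
    s * p * q * r * (p + q + r) ≠ 0 →
    ColumnsAgree 0 1 ![block₁, block₂', glue₂, glueWord' s p q r y - y • block₁]
      ![block₁, block₂', glue₂, glue₁] := by
  decide +kernel

lemma IsSZ.szContains_glue₁ (hC : IsSZ C) (hg : ∀ j, ![block₁, block₂', glue₂] j ∈ C) :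
    SZContains C ![block₁, block₂', glue₂, glue₁] := by
  obtain ⟨s, p, q, r, y, hv, hne⟩ := hC.exists_glueWord'_mem hg
  obtain ⟨hb₁, hb₂, hg₂, -⟩ := by simpa only [forall_vecCons_mem] using hg
  have hsub {b} (hb : b ∈ C) := C.sub_mem hv (C.smul_mem y hb)
  have hentries := glueWord'_ne_zero s p q r y hne (hC.admissible _ hv)
    (hC.admissible _ (C.add_mem (hsub hb₂) hg₂)) (hC.admissible _ (C.sub_mem (hsub hb₂) hg₂))
  exact (columnsAgree_glueWord' s p q r y hentries).szContains
    (by simpa only [forall_vecCons_mem] using ⟨hb₁, hb₂, hg₂, hsub hb₁, nofun⟩)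

/-- A word orthogonal to `block₁`, `block₂'`, `glue₂` and `glue₁` and vanishing at
`1, 2, 3, 4`. -/
def lastWord' (a b y₁ y₂ : ZMod 3) : Fin 12 → ZMod 3 :=
  ![-y₂, 0, 0, 0, 0, a, -a, b, -b, -y₂, y₁, y₂]

lemma IsSZ.exists_lastWord'_mem (hC : IsSZ C)
    (hg : ∀ j, ![block₁, block₂', glue₂, glue₁] j ∈ C) :
    ∃ a b y₁ y₂, lastWord' a b y₁ y₂ ∈ C ∧ lastWord' a b y₁ y₂ ≠ 0 := by
  obtain ⟨v, hv, hne, hk⟩ := hC.exists_vanishing ![1, 2, 3, 4]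
  have hv1 : v 1 = 0 := hk 0
  have hv2 : v 2 = 0 := hk 1
  have hv3 : v 3 = 0 := hk 2
  have hv4 : v 4 = 0 := hk 3
  have h₁ : v 0 + v 11 = 0 := by
    simpa [szForm, xPart, yPart, block₁, dotProduct, Fin.sum_univ_succ, hv1, hv2] using
      hC.szForm_eq_zero (hg 0) hv
  have h₂ : v 9 + v 11 = 0 := by
    simpa [szForm, xPart, yPart, block₂', dotProduct, Fin.sum_univ_succ, hv3, hv4] using
      hC.szForm_eq_zero (hg 1) hv
  have h₃ : v 5 + (v 6 + (v 7 + v 8)) = 0 := by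
    simpa [szForm, xPart, yPart, glue₂, dotProduct, Fin.sum_univ_succ, hv3, hv4] using
      hC.szForm_eq_zero (hg 2) hv
  have h₄ : v 5 + (v 6 + (2 * v 7 + 2 * v 8)) = 0 := by
    simpa [szForm, xPart, yPart, glue₁, dotProduct, Fin.sum_univ_succ, hv1, hv2] using
      hC.szForm_eq_zero (hg 3) hv
  have hv0 : v 0 = -v 11 := by linear_combination h₁
  have hv9 : v 9 = -v 11 := by linear_combination h₂
  have hv6 : v 6 = -v 5 := by linear_combination 2 * h₃ - h₄
  have hv8 : v 8 = -v 7 := by linear_combination h₄ - h₃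
  have hvw := eq_vecCons_apply v
  rw [hv0, hv1, hv2, hv3, hv4, hv6, hv8, hv9] at hvw
  exact ⟨_, _, _, _, hvw ▸ hv, hvw ▸ hne⟩

lemma columnsAgree_lastWord' : ∀ a b y₁ y₂ : ZMod 3, lastWord' a b y₁ y₂ ≠ 0 →
    Admissible (lastWord' a b y₁ y₂) →
    ∃ i : Fin 3, ColumnsAgree 0 1 ![block₁, block₂', glue₂, glue₁, y₂ • lastWord' a b y₁ y₂]
      ![block₁, block₂', glue₂, glue₁,
        ![lastWord' 1 0 1 1, lastWord' 0 1 1 1, lastWord' 1 1 0 1] i] := by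
  decide +kernel

lemma IsSZ.szContains_lastWord' (hC : IsSZ C)
    (hg : ∀ j, ![block₁, block₂', glue₂, glue₁] j ∈ C) :
    ∃ i : Fin 3, SZContains C ![block₁, block₂', glue₂, glue₁,
      ![lastWord' 1 0 1 1, lastWord' 0 1 1 1, lastWord' 1 1 0 1] i] := by
  obtain ⟨a, b, y₁, y₂, hv, hne⟩ := hC.exists_lastWord'_mem hg
  obtain ⟨hb₁, hb₂, hg₂, hg₁, -⟩ := by simpa only [forall_vecCons_mem] using hg
  obtain ⟨i, hi⟩ := columnsAgree_lastWord' a b y₁ y₂ hne (hC.admissible _ hv)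
  exact ⟨i, hi.szContains
    (by simpa only [forall_vecCons_mem] using ⟨hb₁, hb₂, hg₂, hg₁, C.smul_mem y₂ hv, nofun⟩)⟩

/-- The generator matrix `(I₅ | A | B)` of `C12 i`. -/
def G12 (i : Fin 4) : Matrix (Fin 5) (Fin 12) (ZMod 3) :=
  Matrix.of fun r => Fin.append (m := 10) (n := 2) (G10 i r) (ab i r)

lemma szContains_G12_of_combination {k : ℕ} {g : Fin k → Fin 12 → ZMod 3} {i : Fin 4}
    (α : Fin 10 → Fin 2) (τ : Equiv.Perm (Fin 2)) (M : Matrix (Fin 5) (Fin k) (ZMod 3))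
    (h : ColumnsAgree α τ (fun r => ∑ j, M r j • g j) fun r => G12 i r) (hg : ∀ j, g j ∈ C) :
    SZContains C (G12 i) :=
  h.szContains fun r => C.sum_mem fun j _ => C.smul_mem (M r j) (hg j)

lemma szContains_G12_three
    (hg : ∀ j, ![block₁, block₂, block₃, glueWord 1 1 1 0 0, lastWord 0 0 0 1] j ∈ C) :
    SZContains C (G12 3) :=
  szContains_G12_of_combination ![1, 1, 1, 1, 1, 1, 1, 1, 0, 0] 1
    !![0, 0, 0, 0, 1; 0, 2, 0, 0, 0; 2, 0, 0, 0, 0; 1, 1, 1, 1, 1; 1, 1, 2, 1, 2]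
    (by decide +kernel) hg

lemma szContains_G12_one
    (hg : ∀ j, ![block₁, block₂, block₃, glueWord 1 1 1 0 0, lastWord 0 1 1 1] j ∈ C) :
    SZContains C (G12 1) :=
  szContains_G12_of_combination ![0, 0, 0, 0, 0, 0, 0, 0, 0, 1] (Equiv.swap 0 1)
    !![0, 0, 1, 0, 0; 0, 1, 0, 0, 0; 2, 2, 2, 2, 2; 2, 2, 2, 1, 2; 0, 2, 2, 0, 2]
    (by decide +kernel) hg

lemma szContains_G12_two
    (hg : ∀ j, ![block₁, block₂', glue₂, glue₁, lastWord' 1 0 1 1] j ∈ C) :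
    SZContains C (G12 2) :=
  szContains_G12_of_combination ![1, 1, 1, 1, 1, 1, 0, 0, 0, 1] 1
    !![1, 1, 1, 1, 1; 0, 2, 0, 0, 0; 2, 0, 0, 0, 0; 1, 1, 2, 2, 1; 0, 0, 2, 1, 0]
    (by decide +kernel) hg

lemma szContains_G12_two'
    (hg : ∀ j, ![block₁, block₂', glue₂, glue₁, lastWord' 0 1 1 1] j ∈ C) :
    SZContains C (G12 2) :=
  szContains_G12_of_combination ![1, 1, 1, 1, 1, 0, 0, 1, 0, 1] 1
    !![1, 1, 1, 2, 1; 0, 2, 0, 0, 0; 2, 0, 0, 0, 0; 1, 1, 2, 1, 1; 0, 0, 2, 2, 0]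
    (by decide +kernel) hg

lemma szContains_G12_zero
    (hg : ∀ j, ![block₁, block₂', glue₂, glue₁, lastWord' 1 1 0 1] j ∈ C) :
    SZContains C (G12 0) :=
  szContains_G12_of_combination ![0, 0, 0, 0, 0, 1, 1, 0, 1, 0] (Equiv.swap 0 1)
    !![0, 1, 0, 0, 0; 1, 0, 0, 0, 0; 0, 2, 1, 0, 2; 2, 0, 0, 1, 2; 2, 2, 1, 1, 0]
    (by decide +kernel) hg

lemma IsSZ.exists_szContains_G12_of_blocks (hC : IsSZ C)
    (hg : ∀ j, ![block₁, block₂, block₃] j ∈ C) : ∃ i, SZContains C (G12 i) := by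
  refine (hC.szContains_glueWord hg).exists_trans hC fun C' hC' hg' => ?_
  obtain ⟨p, hp⟩ := hC'.szContains_lastWord hg'
  have hsq : ∀ p : ZMod 3, p * p = 0 ∨ p * p = 1 := by decide
  obtain h | h := hsq p <;> rw [h] at hp
  · exact hp.exists_trans hC' fun _ _ hg'' => ⟨3, szContains_G12_three hg''⟩
  · exact hp.exists_trans hC' fun _ _ hg'' => ⟨1, szContains_G12_one hg''⟩

lemma IsSZ.exists_szContains_G12_of_block₂' (hC : IsSZ C)
    (hg : ∀ j, ![block₁, block₂', glue₂] j ∈ C) : ∃ i, SZContains C (G12 i) := by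
  refine (hC.szContains_glue₁ hg).exists_trans hC fun C' hC' hg' => ?_
  obtain ⟨i, hi⟩ := hC'.szContains_lastWord' hg'
  refine hi.exists_trans hC' fun C'' _ hg'' => ?_
  fin_cases i
  exacts [⟨2, szContains_G12_two hg''⟩, ⟨2, szContains_G12_two' hg''⟩,
    ⟨0, szContains_G12_zero hg''⟩]

lemma IsSZ.exists_szContains_G12 (hC : IsSZ C) {c : Fin 12 → ZMod 3} (hc : c ∈ C)
    (h3 : hammingNorm (xPart c) = 3) : ∃ i, SZContains C (G12 i) := by
  refine (hC.szContains_block₁ hc h3).exists_trans hC fun C₁ hC₁ hg₁ => ?_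
  refine (hC₁.szContains_sixOnes hg₁).exists_trans hC₁ fun C₂ hC₂ hg₂ => ?_
  obtain ⟨y, ⟨p, hp, h⟩ | ⟨e, he, h⟩⟩ := hC₂.szContains_sixWord hg₂
  · refine h.exists_trans hC₂ fun C₃ hC₃ hg₃ => ?_
    exact (hC₃.szContains_block₂' hp hg₃).exists_trans hC₃ fun _ hC₄ =>
      hC₄.exists_szContains_G12_of_block₂'
  · refine h.exists_trans hC₂ fun C₃ hC₃ hg₃ => ?_
    exact (hC₃.szContains_blocks he hg₃).exists_trans hC₃ fun _ hC₄ =>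
      hC₄.exists_szContains_G12_of_blocks

end Frames

section FourCodes

variable (i : Fin 4)

lemma linearIndependent_G10 : LinearIndependent (ZMod 3) (G10 i).row := by
  have hentry : ∀ i r c, G10 i r (Fin.castAdd 5 c) = if r = c then 1 else 0 := by decide
  let f := LinearMap.funLeft (ZMod 3) (ZMod 3) (Fin.castAdd 5 : Fin 5 → Fin 10)
  have hone : f ∘ (G10 i).row = (1 : Matrix (Fin 5) (Fin 5) (ZMod 3)).row :=
    funext fun r => funext fun c => (hentry i r c).trans Matrix.one_apply.symm
  exact .of_comp f (hone ▸ Matrix.linearIndependent_rows_of_isUnit isUnit_one)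

lemma xPart_row_G12 (r : Fin 5) : xPart ((G12 i).row r) = (G10 i).row r := by
  funext j
  simp [xPart, G12]

lemma xPart_comp_row_G12 : xPart ∘ (G12 i).row = (G10 i).row :=
  funext (xPart_row_G12 i)

lemma linearIndependent_G12 : LinearIndependent (ZMod 3) (G12 i).row :=
  .of_comp xPart (xPart_comp_row_G12 i ▸ linearIndependent_G10 i)

lemma pun_C12 : Pun (C12 i) = C10 i := by
  have hspan : C12 i = Submodule.span (ZMod 3) (Set.range (G12 i).row) := rfl
  rw [Pun, hspan, Submodule.map_span, ← Set.range_comp, xPart_comp_row_G12, C10, codeOf]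

set_option synthInstance.maxSize 1000 in
set_option maxRecDepth 100000 in
lemma admissible_combination_G12 : ∀ a b c d e : ZMod 3,
    Admissible (a • G12 i 0 + b • G12 i 1 + c • G12 i 2 + d • G12 i 3 + e • G12 i 4) := by
  revert i
  decide +kernel

lemma isSZ_C12 : IsSZ (C12 i) := by
  refine ⟨finrank_codeOf (linearIndependent_G12 i), fun c hc => ?_⟩
  obtain ⟨a, rfl⟩ := mem_codeOf.1 hc
  rw [Fin.sum_univ_five]
  exact admissible_combination_G12 i _ _ _ _ _

lemma exists_hammingNorm_xPart_eq_three_C12 : ∃ c ∈ C12 i, hammingNorm (xPart c) = 3 :=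
  ⟨(G12 i).row 0, Submodule.subset_span ⟨0, rfl⟩, by rw [xPart_row_G12]; revert i; decide⟩

set_option maxRecDepth 100000 in
lemma weightCount_C10_three : weightCount (C10 i) 3 = ![4, 6, 8, 12] i := by
  rw [C10, weightCount_codeOf (linearIndependent_G10 i)]
  revert i
  decide +kernel

variable {i}

lemma eq_of_codeEquiv_C10 {C : Submodule (ZMod 3) (Fin 10 → ZMod 3)} {j : Fin 4}
    (hi : CodeEquiv C (C10 i)) (hj : CodeEquiv C (C10 j)) : i = j := by
  have hcount : (![4, 6, 8, 12] i : ℕ) = ![4, 6, 8, 12] j := by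
    rw [← weightCount_C10_three, ← weightCount_C10_three, hi.weightCount_eq, hj.weightCount_eq]
  clear hi hj
  revert i j
  decide

lemma SZContains.szEquiv_C12 {C : Submodule (ZMod 3) (Fin 12 → ZMod 3)} (hC : IsSZ C)
    (h : SZContains C (G12 i)) : SZEquiv C (C12 i) := by
  obtain ⟨C', hCC', hg⟩ := h
  have hle : C12 i ≤ C' := Submodule.span_le.2 (Set.range_subset_iff.2 hg)
  rwa [Submodule.eq_of_le_of_finrank_eq hle
    ((isSZ_C12 i).finrank_eq.trans (hC.of_szEquiv hCC').finrank_eq.symm)]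

end FourCodes

section Classification

variable {C : Submodule (ZMod 3) (Fin 12 → ZMod 3)}

lemma SZEquiv.codeEquiv_C10 {i : Fin 4} (h : SZEquiv C (C12 i)) : CodeEquiv (Pun C) (C10 i) :=
  pun_C12 i ▸ h.codeEquiv_pun

lemma IsSZ.existsUnique_szEquiv_C12 (hC : IsSZ C) (h : ∃ c ∈ C, hammingNorm (xPart c) = 3) :
    ∃! i, SZEquiv C (C12 i) := by
  obtain ⟨c, hc, h3⟩ := h
  obtain ⟨i, hi⟩ := hC.exists_szContains_G12 hc h3
  have hCi := hi.szEquiv_C12 hC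
  exact ⟨i, hCi, fun j hj => eq_of_codeEquiv_C10 hj.codeEquiv_C10 hCi.codeEquiv_C10⟩

end Classification

theorem mainTheorem4 :
    -- up to SZ-equivalence there are exactly four ternary [12,5,4] codes with the conditions,
    Nat.card (Quotient szSetoid) = 4 ∧
    -- and the four codes `C12 i` form a complete set of representatives
    (∀ i : Fin 4, IsTernaryCode (C12 i) 5 4 ∧ SZConditions (C12 i)) ∧
    (∀ C : Submodule (ZMod 3) (Fin 12 → ZMod 3), IsTernaryCode C 5 4 → SZConditions C →
      ∃! i : Fin 4, SZEquiv C (C12 i)) ∧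
    -- their punctured codes are the pairwise inequivalent [10,5,3] codes `C10 i`
    (∀ i : Fin 4, Pun (C12 i) = C10 i ∧ IsTernaryCode (C10 i) 5 3) ∧
    (∀ i j : Fin 4, CodeEquiv (C10 i) (C10 j) → i = j) ∧
    (∀ C : Submodule (ZMod 3) (Fin 12 → ZMod 3), IsTernaryCode C 5 4 → SZConditions C →
      IsTernaryCode (Pun C) 5 3 ∧ ∃! i : Fin 4, CodeEquiv (Pun C) (C10 i)) := by
  have hrep (i : Fin 4) : IsTernaryCode (C12 i) 5 4 ∧ SZConditions (C12 i) :=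
    ⟨(isSZ_C12 i).isTernaryCode (exists_hammingNorm_xPart_eq_three_C12 i),
      szConditions_iff.2 (isSZ_C12 i).admissible⟩
  have hclass {C} (hC : IsTernaryCode C 5 4) (h : SZConditions C) : ∃! i, SZEquiv C (C12 i) :=
    (h.isSZ hC).existsUnique_szEquiv_C12 ((h.isSZ hC).exists_hammingNorm_xPart_eq_three hC)
  have hpun {C} (hC : IsTernaryCode C 5 4) (h : SZConditions C) : IsTernaryCode (Pun C) 5 3 :=
    (h.isSZ hC).isTernaryCode_pun ((h.isSZ hC).exists_hammingNorm_xPart_eq_three hC)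
  refine ⟨?_, hrep, fun C => hclass, fun i => ⟨pun_C12 i, pun_C12 i ▸ hpun (hrep i).1 (hrep i).2⟩,
    fun i j => eq_of_codeEquiv_C10 (CodeEquiv.refl _), fun C hC h => ⟨hpun hC h, ?_⟩⟩
  · rw [natCard_quotient_eq szSetoid (fun i => ⟨C12 i, hrep i⟩) fun C => hclass C.2.1 C.2.2,
      Nat.card_fin]
  · obtain ⟨i, hi, -⟩ := hclass hC h
    exact ⟨i, hi.codeEquiv_C10, fun j hj => eq_of_codeEquiv_C10 hj hi.codeEquiv_C10⟩
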